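/- Let $E,F$ be real Banach lattices, with dual spaces $E',F'$ ($F'$ is a Banach lattice under the order $f\le g\iff f(y)\le g(y)$ for all $y\ge 0$ in $F$). For a subset $A$ of a Banach lattice $G$, the solid hull of $A$ is $Sol(A)=\{y\in G: |y|\le |x| \text{ for some } x\in A\}$; a sequence $(x_n)$ in $G$ is disjoint if $|x_n|\wedge|x_m|=0$ for $n\neq m$; and $A$ is called disjointly weakly compact if it is norm bounded and every disjoint sequence in $Sol(A)$ converges weakly to zero. A norm bounded subset $B$ of a Banach space $X$ is called a Dunford-Pettis set if $\sup_{x\in B}|f_n(x)|\to 0$ for every weakly null sequence $(f_n)$ in $X'$. A bounded linear operator $T:E\to F$ is called a $DW$-DP operator if $T(A)$ is a Dunford-Pettis set for every disjointly weakly compact set $A\subset E$. **Theorem.** Let $T:E\to F$ be a positive $DW$-DP operator between Banach lattices, and let $W\subset E$ and $V\subset F'$ be disjointly weakly compact sets. Then the following statements hold. 1. For every disjoint sequence $(x_n)$ in $Sol(W)$, the sequence $(Tx_n)$ converges to zero uniformly on $Sol(V)$, that is, $\sup_{f\in Sol(V)}|f(Tx_n)|\to 0$. 2. For each $\varepsilon>0$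 there exists $u\in E^+$ such that $\langle |f|,\,T[(|x|-u)^+]\rangle<\varepsilon$ for all $x\in W$ and all $f\in V$. -/

import Mathlib

open Filter Topology
open LatticeOrderedAddCommGroup (solidClosure)

/-! ## The dual of a Banach lattice as a vector lattice

The dual `F'` carries the order `f ≤ g ↔ ∀ x ≥ 0, f x ≤ g x`. The positive part of `f` is given by
`f⁺ x = sup {f y | 0 ≤ y ≤ x}` for `x ≥ 0`, extended to all of `F` by linearity. -/

namespace DualLattice

section

variable {F : Type*} [NormedAddCommGroup F] [NormedSpace ℝ F] [Lattice F]

/-- `x ↦ sup {f y | 0 ≤ y ≤ x}`, to be used for `x ≥ 0`. -/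
noncomputable def coneSup (f : StrongDual ℝ F) (x : F) : ℝ := sSup (f '' Set.Icc 0 x)

lemma coneSup_le (f : StrongDual ℝ F) {x : F} (hx : 0 ≤ x) {c : ℝ}
    (h : ∀ y, 0 ≤ y → y ≤ x → f y ≤ c) : coneSup f x ≤ c := by
  refine csSup_le ⟨f 0, 0, ⟨le_rfl, hx⟩, rfl⟩ ?_
  rintro _ ⟨y, hy, rfl⟩
  exact h y hy.1 hy.2

variable [IsOrderedAddMonoid F] [HasSolidNorm F]

lemma apply_le_norm (f : StrongDual ℝ F) {x y : F} (hy : 0 ≤ y) (hyx : y ≤ x) :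
    f y ≤ ‖f‖ * ‖x‖ := by
  have h1 : ‖y‖ ≤ ‖x‖ := norm_le_norm_of_abs_le_abs (by
    rwa [abs_of_nonneg hy, abs_of_nonneg (hy.trans hyx)])
  calc f y ≤ ‖f y‖ := le_abs_self _
    _ ≤ ‖f‖ * ‖y‖ := f.le_opNorm y
    _ ≤ ‖f‖ * ‖x‖ := by gcongr

lemma bddAbove_image (f : StrongDual ℝ F) (x : F) : BddAbove (f '' Set.Icc 0 x) := by
  refine ⟨‖f‖ * ‖x‖, ?_⟩
  rintro _ ⟨y, hy, rfl⟩
  exact apply_le_norm f hy.1 hy.2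

lemma le_coneSup (f : StrongDual ℝ F) {x y : F} (hy : 0 ≤ y) (hyx : y ≤ x) :
    f y ≤ coneSup f x :=
  le_csSup (bddAbove_image f x) ⟨y, ⟨hy, hyx⟩, rfl⟩

lemma coneSup_nonneg (f : StrongDual ℝ F) {x : F} (hx : 0 ≤ x) : 0 ≤ coneSup f x := by
  simpa using le_coneSup f le_rfl hx

lemma coneSup_add (f : StrongDual ℝ F) {x y : F} (hx : 0 ≤ x) (hy : 0 ≤ y) :
    coneSup f (x + y) = coneSup f x + coneSup f y := by
  apply le_antisymm
  · refine coneSup_le f (add_nonneg hx hy) fun z hz hzxy => ?_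
    have h1 : 0 ≤ z - z ⊓ x := sub_nonneg.2 inf_le_left
    have h2 : z - z ⊓ x ≤ y := by
      rw [sub_le_iff_le_add, ← sub_le_iff_le_add']
      exact le_inf (sub_le_self _ hy) (by rwa [sub_le_iff_le_add])
    have h3 := le_coneSup f (le_inf hz hx) (inf_le_right : z ⊓ x ≤ x)
    have h4 := le_coneSup f h1 h2
    rw [map_sub] at h4
    linarith
  · have key : ∀ b, 0 ≤ b → b ≤ y → coneSup f x ≤ coneSup f (x + y) - f b := by
      intro b hb hby
      refine coneSup_le f hx fun a ha hax => ?_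
      have := le_coneSup f (add_nonneg ha hb) (add_le_add hax hby)
      rw [map_add] at this
      linarith
    have : coneSup f y ≤ coneSup f (x + y) - coneSup f x :=
      coneSup_le f hy fun b hb hby => by linarith [key b hb hby]
    linarith

lemma coneSup_sub_eq (f : StrongDual ℝ F) {a b c d : F} (ha : 0 ≤ a) (hb : 0 ≤ b) (hc : 0 ≤ c)
    (hd : 0 ≤ d) (h : a - b = c - d) :
    coneSup f a - coneSup f b = coneSup f c - coneSup f d := by
  have h1 : a + d = c + b := by
    rw [sub_eq_sub_iff_add_eq_add] at h
    exact h
  have h2 := coneSup_add f ha hd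
  rw [h1, coneSup_add f hc hb] at h2
  linarith

/-- The positive part of `f` as an additive map. -/
noncomputable def posAddHom (f : StrongDual ℝ F) : F →+ ℝ :=
  AddMonoidHom.mk' (fun x => coneSup f x⁺ - coneSup f x⁻) fun x y => by
    have h := coneSup_sub_eq f (posPart_nonneg (x + y)) (negPart_nonneg (x + y))
      (add_nonneg (posPart_nonneg x) (posPart_nonneg y))
      (add_nonneg (negPart_nonneg x) (negPart_nonneg y)) (by
        rw [add_sub_add_comm, posPart_sub_negPart, posPart_sub_negPart, posPart_sub_negPart])
    rw [coneSup_add f (posPart_nonneg x) (posPart_nonneg y),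
      coneSup_add f (negPart_nonneg x) (negPart_nonneg y)] at h
    linarith

lemma posAddHom_of_nonneg (f : StrongDual ℝ F) {x : F} (hx : 0 ≤ x) :
    posAddHom f x = coneSup f x := by
  have h0 : coneSup f 0 = 0 := by simp [coneSup]
  simp [posAddHom, posPart_of_nonneg hx, negPart_of_nonneg hx, h0]

lemma norm_posAddHom_le (f : StrongDual ℝ F) (x : F) : ‖posAddHom f x‖ ≤ ‖f‖ * ‖x‖ := by
  have hp := coneSup_nonneg f (posPart_nonneg x)
  have hn := coneSup_nonneg f (negPart_nonneg x)
  have h1 : coneSup f x⁺ + coneSup f x⁻ ≤ ‖f‖ * ‖x‖ := by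
    rw [← coneSup_add f (posPart_nonneg x) (negPart_nonneg x), posPart_add_negPart]
    refine coneSup_le f (abs_nonneg x) fun y hy hyx => ?_
    rw [← norm_abs_eq_norm x]
    exact apply_le_norm f hy hyx
  change |coneSup f x⁺ - coneSup f x⁻| ≤ _
  rw [abs_le]
  constructor <;> linarith

/-- The positive part of a functional in the dual. -/
noncomputable def pos (f : StrongDual ℝ F) : StrongDual ℝ F :=
  (posAddHom f).toRealLinearMap
    (AddMonoidHomClass.continuous_of_bound (posAddHom f) ‖f‖ (norm_posAddHom_le f))

lemma pos_of_nonneg (f : StrongDual ℝ F) {x : F} (hx : 0 ≤ x) : pos f x = coneSup f x :=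
  posAddHom_of_nonneg f hx

/-- The dual of a Banach lattice, ordered by `f ≤ g ↔ ∀ x ≥ 0, f x ≤ g x`, is a lattice. -/
noncomputable instance instLatticeStrongDual : Lattice (StrongDual ℝ F) where
  le f g := ∀ x, 0 ≤ x → f x ≤ g x
  le_refl f x _ := le_rfl
  le_trans f g h hfg hgh x hx := (hfg x hx).trans (hgh x hx)
  le_antisymm f g hfg hgf := by
    have h : ∀ x, 0 ≤ x → f x = g x := fun x hx => le_antisymm (hfg x hx) (hgf x hx)
    ext x
    rw [← posPart_sub_negPart x, map_sub, map_sub, h _ (posPart_nonneg x),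
      h _ (negPart_nonneg x)]
  sup f g := f + pos (g - f)
  le_sup_left f g x hx := by
    have := coneSup_nonneg (g - f) hx
    simpa [pos_of_nonneg _ hx] using this
  le_sup_right f g x hx := by
    have := le_coneSup (g - f) hx le_rfl
    rw [sub_apply] at this
    rw [add_apply, pos_of_nonneg _ hx]
    linarith
  sup_le f g h hfh hgh x hx := by
    rw [add_apply, pos_of_nonneg _ hx, ← le_sub_iff_add_le']
    refine coneSup_le _ hx fun y hy hyx => ?_
    have h1 := hgh y hy
    have h2 := hfh (x - y) (sub_nonneg.2 hyx)
    rw [map_sub, map_sub] at h2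
    rw [sub_apply]
    linarith
  inf f g := f - pos (f - g)
  inf_le_left f g x hx := by
    have := coneSup_nonneg (f - g) hx
    rw [sub_apply, pos_of_nonneg _ hx]
    linarith
  inf_le_right f g x hx := by
    have := le_coneSup (f - g) hx le_rfl
    rw [sub_apply] at this
    rw [sub_apply, pos_of_nonneg _ hx]
    linarith
  le_inf f g h hfg hfh x hx := by
    rw [sub_apply, pos_of_nonneg _ hx, le_sub_comm]
    refine coneSup_le _ hx fun y hy hyx => ?_
    have h1 := hfh y hy
    have h2 := hfg (x - y) (sub_nonneg.2 hyx)
    rw [map_sub, map_sub] at h2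
    rw [sub_apply]
    linarith

end

end DualLattice

/-! ## Weakly null sequences, Dunford-Pettis sets, disjointly weakly compact sets -/

/-- `x n → 0` weakly. -/
def WeaklyNull {X : Type*} [NormedAddCommGroup X] [NormedSpace ℝ X] (x : ℕ → X) : Prop :=
  ∀ φ : StrongDual ℝ X, Tendsto (fun n => φ (x n)) atTop (𝓝 0)

/-- A bounded set on which every weakly null sequence of the dual converges uniformly to zero. -/
def IsDunfordPettisSet {X : Type*} [NormedAddCommGroup X] [NormedSpace ℝ X] (A : Set X) : Prop :=
  Bornology.IsBounded A ∧
    ∀ f : ℕ → StrongDual ℝ X, WeaklyNull f →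
      TendstoUniformlyOn (fun n x => f n x) (fun _ => 0) atTop A

/-- A sequence with pairwise disjoint terms, `|x m| ⊓ |x n| = 0` for `m ≠ n`. -/
def IsDisjointSeq {E : Type*} [AddCommGroup E] [Lattice E] (x : ℕ → E) : Prop :=
  Pairwise fun m n => |x m| ⊓ |x n| = 0

/-- A bounded set such that every disjoint sequence in its solid hull
`{y | ∃ x ∈ A, |y| ≤ |x|}` is weakly null. -/
def IsDisjointlyWeaklyCompact {E : Type*} [NormedAddCommGroup E] [NormedSpace ℝ E] [Lattice E]
    (A : Set E) : Prop :=
  Bornology.IsBounded A ∧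
    ∀ x : ℕ → E, (∀ n, x n ∈ solidClosure A) → IsDisjointSeq x → WeaklyNull x

/-- A bounded linear operator which maps disjointly weakly compact sets to Dunford-Pettis sets. -/
def IsDWDPOperator {E X : Type*} [NormedAddCommGroup E] [NormedSpace ℝ E] [Lattice E]
    [NormedAddCommGroup X] [NormedSpace ℝ X] (T : E →L[ℝ] X) : Prop :=
  ∀ A : Set E, IsDisjointlyWeaklyCompact A → IsDunfordPettisSet (T '' A)

/-!
Both assertions come from one domination principle, `exists_forall_apply_posPart_abs_sub_lt`: if a
norm bounded family of positive functionals on a Banach lattice tends to zero uniformly along every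
positive disjoint sequence of `Sol(A)`, then for each `ε > 0` there is `u ≥ 0` such that every
member of the family is `< ε` at all `(|x| - u)⁺` with `x ∈ A`. Otherwise one could choose
`x₀, x₁, …` in `A` such that some member of the family is `≥ ε` at
`(|xₙ| - 4ⁿ (|x₀| + ⋯ + |xₙ₋₁|))⁺`; subtracting in addition `2⁻ⁿ z`, where `z = ∑ 2⁻ⁱ |xᵢ|`, makes
these vectors disjoint (`isDisjointSeq_posPart_sub`) and changes the values by `O(2⁻ⁿ)` only.

For the first assertion, the principle is applied in `F'` to `A = V` and the evaluations at
`yₙ = T |xₙ|`. The set `{|xₙ|}` is disjointly weakly compact, so `{yₙ}` is a Dunford-Pettis set, and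
disjoint sequences in `Sol(V)`, being weakly null, tend to zero uniformly on it. This gives
`g ∈ F'₊` with `(|f| - g)⁺ yₙ < ε`, hence `|f| yₙ ≤ ε + g yₙ`, for all `f ∈ V` and all `n`. Finally
`g yₙ → 0`, since `(|xₙ|)` is a disjoint sequence in `Sol(W)`.

For the second assertion, the principle is applied in `E` to `A = W` and the functionals `|f| ∘ T`
with `f ∈ V`; its hypothesis is the first assertion.

To use the principle in `F'`, the dual is first shown to be a Banach lattice.
-/

/-! ### The dual of a Banach lattice is a Banach lattice -/

namespace DualLattice

section

variable {F : Type*} [NormedAddCommGroup F] [NormedSpace ℝ F] [Lattice F]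
  [IsOrderedAddMonoid F] [HasSolidNorm F]

lemma le_iff {f g : StrongDual ℝ F} : f ≤ g ↔ ∀ x, 0 ≤ x → f x ≤ g x := Iff.rfl

instance instIsOrderedAddMonoidStrongDual : IsOrderedAddMonoid (StrongDual ℝ F) where
  add_le_add_left f g h k := le_iff.2 fun x hx => by
    simpa using le_iff.1 h x hx

instance instIsOrderedModuleStrongDual : IsOrderedModule ℝ (StrongDual ℝ F) where
  smul_le_smul_of_nonneg_left a ha f g h := le_iff.2 fun x hx => by
    simpa using mul_le_mul_of_nonneg_left (le_iff.1 h x hx) ha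
  smul_le_smul_of_nonneg_right f hf a b h := le_iff.2 fun x hx => by
    have := le_iff.1 hf x hx
    simpa using mul_le_mul_of_nonneg_right h (by simpa using this)

lemma apply_nonneg {f : StrongDual ℝ F} (hf : 0 ≤ f) {x : F} (hx : 0 ≤ x) : 0 ≤ f x := by
  simpa using le_iff.1 hf x hx

lemma apply_mono {f : StrongDual ℝ F} (hf : 0 ≤ f) {x y : F} (h : x ≤ y) : f x ≤ f y := by
  have := apply_nonneg hf (sub_nonneg.2 h)
  rw [map_sub] at this
  linarith

lemma abs_apply_le (f : StrongDual ℝ F) (x : F) : |f x| ≤ |f| |x| := by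
  have h1 : ∀ y, 0 ≤ y → f y ≤ |f| y := le_iff.1 (le_abs_self f)
  have h2 : ∀ y, 0 ≤ y → -f y ≤ |f| y := fun y hy => by
    simpa using le_iff.1 (neg_le_abs f) y hy
  have hp := posPart_nonneg x
  have hn := negPart_nonneg x
  have hx : f x = f x⁺ - f x⁻ := by rw [← map_sub, posPart_sub_negPart]
  rw [hx, ← posPart_add_negPart x, map_add, abs_le]
  constructor <;> linarith [h1 _ hp, h1 _ hn, h2 _ hp, h2 _ hn]

lemma abs_apply_le_norm (f : StrongDual ℝ F) {x : F} (hx : 0 ≤ x) : |f| x ≤ ‖f‖ * ‖x‖ := by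
  have habs : |f| = f + pos (-f - f) := rfl
  -- `|f| x` is the supremum of the values `f (x - 2 y)`, and `|x - 2 y| ≤ x`, for `0 ≤ y ≤ x`.
  rw [habs, add_apply, pos_of_nonneg _ hx, ← le_sub_iff_add_le']
  refine coneSup_le _ hx fun y hy hyx => ?_
  have h1 : ‖x - y - y‖ ≤ ‖x‖ := norm_le_norm_of_abs_le_abs (by
    rw [abs_of_nonneg hx]
    refine abs_le'.2 ⟨(sub_le_self _ hy).trans (sub_le_self _ hy), ?_⟩
    rw [← sub_nonneg]
    have : x - -(x - y - y) = (x - y) + (x - y) := by abel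
    rw [this]
    exact add_nonneg (sub_nonneg.2 hyx) (sub_nonneg.2 hyx))
  have h2 : f (x - y - y) ≤ ‖f‖ * ‖x‖ :=
    (le_abs_self _).trans ((f.le_opNorm _).trans (by gcongr))
  rw [map_sub, map_sub] at h2
  rw [sub_apply, neg_apply]
  linarith

instance instHasSolidNormStrongDual : HasSolidNorm (StrongDual ℝ F) where
  solid f g h := f.opNorm_le_bound (norm_nonneg g) fun x => by
    calc ‖f x‖ ≤ |f| |x| := abs_apply_le f x
      _ ≤ |g| |x| := le_iff.1 h _ (abs_nonneg x)
      _ ≤ ‖g‖ * ‖|x|‖ := abs_apply_le_norm g (abs_nonneg x)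
      _ = ‖g‖ * ‖x‖ := by rw [norm_abs_eq_norm]

end

end DualLattice

/-! ### Disjoint sequences and solid hulls -/

lemma solidClosure_subset_of_subset {G : Type*} [AddCommGroup G] [Lattice G] {A B : Set G}
    (h : A ⊆ solidClosure B) : solidClosure A ⊆ solidClosure B := by
  rintro y ⟨a, ha, hya⟩
  obtain ⟨b, hb, hab⟩ := h ha
  exact ⟨b, hb, hya.trans hab⟩

section

variable {G : Type*} [AddCommGroup G] [Lattice G] [IsOrderedAddMonoid G]

lemma IsDisjointSeq.abs {x : ℕ → G} (hx : IsDisjointSeq x) : IsDisjointSeq fun n => |x n| :=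
  fun m n hmn => by simpa only [abs_abs] using hx hmn

lemma abs_mem_solidClosure {A : Set G} {x : G} (hx : x ∈ solidClosure A) :
    |x| ∈ solidClosure A := by
  obtain ⟨a, ha, h⟩ := hx
  exact ⟨a, ha, by rwa [abs_abs]⟩

lemma posPart_le_posPart_sub_add {a b : G} (hb : 0 ≤ b) : a⁺ ≤ (a - b)⁺ + b := by
  refine sup_le ?_ (add_nonneg (posPart_nonneg _) hb)
  rw [← sub_le_iff_le_add]
  exact le_posPart _

/-- If `s` dominates the earlier terms of `x` and `z` dominates every `2⁻ᵐ xₘ`, then the positive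
parts of `xₙ - 4ⁿ sₙ - 2⁻ⁿ z` are pairwise disjoint. -/
lemma isDisjointSeq_posPart_sub [Module ℝ G] [IsOrderedModule ℝ G] {x s : ℕ → G} {z : G}
    (hs : ∀ n, 0 ≤ s n) (hz : 0 ≤ z) (hxs : ∀ m n, m < n → x m ≤ s n)
    (hxz : ∀ m, (2⁻¹ : ℝ) ^ m • x m ≤ z) :
    IsDisjointSeq fun n => (x n - (4 : ℝ) ^ n • s n - (2⁻¹ : ℝ) ^ n • z)⁺ := by
  set y : ℕ → G := fun n => (x n - (4 : ℝ) ^ n • s n - (2⁻¹ : ℝ) ^ n • z)⁺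
  have hy0 : ∀ n, 0 ≤ y n := fun n => posPart_nonneg _
  have key : ∀ m n, m < n → y m ⊓ y n = 0 := by
    intro m n hmn
    -- The two terms lie below the negative and the positive part of the same vector.
    set a : G := x n - (4 : ℝ) ^ n • x m with ha
    have h1 : y n ≤ a⁺ := by
      refine posPart_mono ((sub_le_self _ (smul_nonneg (by positivity) hz)).trans ?_)
      exact sub_le_sub_left (smul_le_smul_of_nonneg_left (hxs m n hmn) (by positivity)) _
    have h2 : (4 : ℝ) ^ n • y m ≤ a⁻ := by
      have hle : (4 : ℝ) ^ n • (x m - (4 : ℝ) ^ m • s m - (2⁻¹ : ℝ) ^ m • z) ≤ -a := by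
        have h3 : x n ≤ (4 : ℝ) ^ n • (2⁻¹ : ℝ) ^ m • z := by
          have h4 : x n = (2 : ℝ) ^ n • (2⁻¹ : ℝ) ^ n • x n := by
            rw [smul_smul, ← mul_pow]
            norm_num
          have h5 : (2 : ℝ) ^ n ≤ (4 : ℝ) ^ n * (2⁻¹ : ℝ) ^ m := by
            have : (2⁻¹ : ℝ) ^ n ≤ (2⁻¹ : ℝ) ^ m :=
              pow_le_pow_of_le_one (by norm_num) (by norm_num) hmn.le
            calc (2 : ℝ) ^ n = (4 : ℝ) ^ n * (2⁻¹ : ℝ) ^ n := by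
                  rw [← mul_pow]
                  norm_num
              _ ≤ _ := by gcongr
          calc x n = (2 : ℝ) ^ n • (2⁻¹ : ℝ) ^ n • x n := h4
            _ ≤ (2 : ℝ) ^ n • z := smul_le_smul_of_nonneg_left (hxz n) (by positivity)
            _ ≤ ((4 : ℝ) ^ n * (2⁻¹ : ℝ) ^ m) • z := smul_le_smul_of_nonneg_right h5 hz
            _ = _ := (smul_smul _ _ _).symm
        have h6 : 0 ≤ (4 : ℝ) ^ n • (4 : ℝ) ^ m • s m :=
          smul_nonneg (by positivity) (smul_nonneg (by positivity) (hs m))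
        rw [smul_sub, smul_sub, ha, neg_sub]
        exact sub_le_sub (sub_le_self _ h6) h3
      have hpos : (0 : ℝ) < 4 ^ n := by positivity
      rw [← le_inv_smul_iff_of_pos hpos]
      refine sup_le ?_ (smul_nonneg (by positivity) (negPart_nonneg a))
      rw [le_inv_smul_iff_of_pos hpos]
      exact hle.trans (neg_le_negPart a)
    have h3 : y m ≤ (4 : ℝ) ^ n • y m := by
      have := smul_le_smul_of_nonneg_right (one_le_pow₀ (by norm_num : (1 : ℝ) ≤ 4) (n := n))
        (hy0 m)
      rwa [one_smul] at this
    refine le_antisymm ?_ (le_inf (hy0 m) (hy0 n))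
    calc y m ⊓ y n ≤ a⁻ ⊓ a⁺ := inf_le_inf (h3.trans h2) h1
      _ = 0 := by rw [inf_comm, posPart_inf_negPart_eq_zero]
  intro m n hmn
  rw [abs_of_nonneg (hy0 m), abs_of_nonneg (hy0 n)]
  rcases lt_or_gt_of_ne hmn with h | h
  · exact key m n h
  · rw [inf_comm]
    exact key n m h

end

lemma isBounded_solidClosure {G : Type*} [NormedAddCommGroup G] [Lattice G]
    [HasSolidNorm G] {A : Set G} (hA : Bornology.IsBounded A) :
    Bornology.IsBounded (solidClosure A) := by
  obtain ⟨C, hC⟩ := hA.exists_norm_le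
  refine isBounded_iff_forall_norm_le.2 ⟨C, ?_⟩
  rintro y ⟨x, hx, hyx⟩
  exact (norm_le_norm_of_abs_le_abs hyx).trans (hC x hx)

lemma IsDisjointlyWeaklyCompact.of_subset_solidClosure {G : Type*} [NormedAddCommGroup G]
    [NormedSpace ℝ G] [Lattice G] [HasSolidNorm G] {A B : Set G}
    (hB : IsDisjointlyWeaklyCompact B) (h : A ⊆ solidClosure B) : IsDisjointlyWeaklyCompact A :=
  ⟨(isBounded_solidClosure hB.1).subset h, fun x hx hd =>
    hB.2 x (fun n => solidClosure_subset_of_subset h (hx n)) hd⟩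

/-! ### The domination principle -/

section

variable {G : Type*} [NormedAddCommGroup G] [Lattice G] [IsOrderedAddMonoid G] [HasSolidNorm G]

lemma exists_forall_inv_two_pow_smul_le [NormedSpace ℝ G] [CompleteSpace G] [IsOrderedModule ℝ G]
    {x : ℕ → G} (hx : ∀ n, 0 ≤ x n) {C : ℝ} (hC : ∀ n, ‖x n‖ ≤ C) :
    ∃ z, 0 ≤ z ∧ ∀ n, (2⁻¹ : ℝ) ^ n • x n ≤ z := by
  have h0 : ∀ n, 0 ≤ (2⁻¹ : ℝ) ^ n • x n := fun n => smul_nonneg (by positivity) (hx n)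
  have hsum : Summable fun n => (2⁻¹ : ℝ) ^ n • x n := by
    refine Summable.of_norm_bounded
      ((summable_geometric_of_lt_one (by norm_num) (by norm_num : (2⁻¹ : ℝ) < 1)).mul_right C)
      fun n => ?_
    rw [norm_smul, norm_pow, Real.norm_of_nonneg (by norm_num : (0 : ℝ) ≤ 2⁻¹)]
    exact mul_le_mul_of_nonneg_left (hC n) (by positivity)
  exact ⟨_, tsum_nonneg h0, fun n => hsum.le_tsum n fun m _ => h0 m⟩

/-- A norm bounded family of positive functionals which converges to zero uniformly along every
positive disjoint sequence in the solid hull of a bounded set `A` is uniformly small on `A` outside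
some order interval. -/
theorem exists_forall_apply_posPart_abs_sub_lt [NormedSpace ℝ G] [CompleteSpace G]
    [IsOrderedModule ℝ G] {ι : Type*} {φ : ι → StrongDual ℝ G} (hφ : ∀ i, 0 ≤ φ i)
    {C : ℝ} (hC : ∀ i, ‖φ i‖ ≤ C) {A : Set G} (hA : Bornology.IsBounded A)
    (h : ∀ x : ℕ → G, (∀ n, 0 ≤ x n) → (∀ n, x n ∈ solidClosure A) → IsDisjointSeq x →
      ∀ ε > 0, ∀ᶠ n in atTop, ∀ i, φ i (x n) < ε)
    {ε : ℝ} (hε : 0 < ε) :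
    ∃ u, 0 ≤ u ∧ ∀ x ∈ A, ∀ i, φ i (|x| - u)⁺ < ε := by
  by_contra! hcon
  have hcon' : ∀ u : G, ∃ x, 0 ≤ u → x ∈ A ∧ ∃ i, ε ≤ φ i (|x| - u)⁺ := fun u => by
    by_cases hu : 0 ≤ u
    · obtain ⟨x, hx, hi⟩ := hcon u hu
      exact ⟨x, fun _ => ⟨hx, hi⟩⟩
    · exact ⟨0, fun hu' => absurd hu' hu⟩
  choose p hp using hcon'
  -- `s n` is the sum of the moduli of the first `n` chosen points of `A`.
  let s : ℕ → G := fun n => n.rec 0 fun k r => r + |p ((4 : ℝ) ^ k • r)|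
  let x : ℕ → G := fun n => |p ((4 : ℝ) ^ n • s n)|
  have hsucc : ∀ n, s (n + 1) = s n + x n := fun n => rfl
  have hx0 : ∀ n, 0 ≤ x n := fun n => abs_nonneg _
  have hmono : Monotone s := monotone_nat_of_le_succ fun n => by
    rw [hsucc]
    exact le_add_of_nonneg_right (hx0 n)
  have hs0 : ∀ n, 0 ≤ s n := fun n => hmono (Nat.zero_le n)
  have hxs : ∀ m n, m < n → x m ≤ s n := fun m n hmn => by
    refine le_trans ?_ (hmono (Nat.succ_le_of_lt hmn))
    rw [Nat.succ_eq_add_one, hsucc]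
    exact le_add_of_nonneg_left (hs0 m)
  have hu0 : ∀ n, 0 ≤ (4 : ℝ) ^ n • s n := fun n => smul_nonneg (by positivity) (hs0 n)
  obtain ⟨D, hD⟩ := hA.exists_norm_le
  obtain ⟨z, hz0, hz⟩ := exists_forall_inv_two_pow_smul_le hx0 (C := D) fun n => by
    rw [norm_abs_eq_norm]
    exact hD _ (hp _ (hu0 n)).1
  set y : ℕ → G := fun n => (x n - (4 : ℝ) ^ n • s n - (2⁻¹ : ℝ) ^ n • z)⁺
  have hy0 : ∀ n, 0 ≤ y n := fun n => posPart_nonneg _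
  have hyA : ∀ n, y n ∈ solidClosure A := fun n => by
    refine ⟨_, (hp _ (hu0 n)).1, ?_⟩
    rw [abs_of_nonneg (hy0 n)]
    exact sup_le ((sub_le_self _ (smul_nonneg (by positivity) hz0)).trans
      (sub_le_self _ (hu0 n))) (abs_nonneg _)
  have hsmall : Tendsto (fun n : ℕ => (2⁻¹ : ℝ) ^ n * (C * ‖z‖)) atTop (𝓝 0) := by
    simpa using (tendsto_pow_atTop_nhds_zero_of_lt_one (by norm_num)
      (by norm_num : (2⁻¹ : ℝ) < 1)).mul_const (C * ‖z‖)
  obtain ⟨n, hn1, hn2⟩ := ((h y hy0 hyA (isDisjointSeq_posPart_sub hs0 hz0 hxs hz) (ε / 2)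
    (half_pos hε)).and (hsmall.eventually (gt_mem_nhds (half_pos hε)))).exists
  obtain ⟨i, hi⟩ := (hp _ (hu0 n)).2
  have h1 : φ i (x n - (4 : ℝ) ^ n • s n)⁺ ≤ φ i (y n + (2⁻¹ : ℝ) ^ n • z) :=
    DualLattice.apply_mono (hφ i)
      (posPart_le_posPart_sub_add (smul_nonneg (by positivity) hz0))
  have h2 : φ i z ≤ C * ‖z‖ :=
    (le_abs_self _).trans (((φ i).le_opNorm z).trans (by gcongr; exact hC i))
  have h3 : (2⁻¹ : ℝ) ^ n * φ i z ≤ (2⁻¹ : ℝ) ^ n * (C * ‖z‖) := by gcongr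
  rw [map_add, map_smul, smul_eq_mul] at h1
  have h4 : ε ≤ φ i (x n - (4 : ℝ) ^ n • s n)⁺ := hi
  linarith [hn1 i]

end

/-! ### Positive DW-DP operators -/

lemma abs_apply_le_apply_abs
    {E : Type*} [NormedAddCommGroup E] [NormedSpace ℝ E] [Lattice E] [IsOrderedAddMonoid E]
    {F : Type*} [NormedAddCommGroup F] [NormedSpace ℝ F] [Lattice F] [IsOrderedAddMonoid F]
    {T : E →L[ℝ] F} (hT : ∀ x : E, 0 ≤ x → 0 ≤ T x) (x : E) : |T x| ≤ T |x| := by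
  have hmono : ∀ a b : E, a ≤ b → T a ≤ T b := fun a b hab => by
    rw [← sub_nonneg, ← map_sub]
    exact hT _ (sub_nonneg.2 hab)
  refine abs_le'.2 ⟨hmono _ _ (le_abs_self x), ?_⟩
  rw [← map_neg]
  exact hmono _ _ (neg_le_abs x)

section

variable {E : Type*} [NormedAddCommGroup E] [NormedSpace ℝ E] [Lattice E]
  [IsOrderedAddMonoid E] [HasSolidNorm E]
  {F : Type*} [NormedAddCommGroup F] [NormedSpace ℝ F] [Lattice F]
  [IsOrderedAddMonoid F] [HasSolidNorm F]

theorem IsDWDPOperator.tendstoUniformlyOn_solidClosure {T : E →L[ℝ] F}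
    (hTpos : ∀ x : E, 0 ≤ x → 0 ≤ T x) (hT : IsDWDPOperator T)
    {W : Set E} (hW : IsDisjointlyWeaklyCompact W)
    {V : Set (StrongDual ℝ F)} (hV : IsDisjointlyWeaklyCompact V)
    {x : ℕ → E} (hxW : ∀ n, x n ∈ solidClosure W) (hx : IsDisjointSeq x) :
    TendstoUniformlyOn (fun n (f : StrongDual ℝ F) => f (T (x n))) (fun _ => 0) atTop
      (solidClosure V) := by
  have hsub : Set.range (fun n => |x n|) ⊆ solidClosure W := by
    rintro _ ⟨n, rfl⟩
    exact abs_mem_solidClosure (hxW n)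
  have hDP := hT _ (hW.of_subset_solidClosure hsub)
  have hnull : WeaklyNull fun n => |x n| := hW.2 _ (fun n => hsub ⟨n, rfl⟩) hx.abs
  let y : ℕ → F := fun n => T |x n|
  have hy0 : ∀ n, 0 ≤ y n := fun n => hTpos _ (abs_nonneg _)
  have hyT : ∀ n, y n ∈ T '' Set.range (fun n => |x n|) := fun n => ⟨_, ⟨n, rfl⟩, rfl⟩
  obtain ⟨C, hC⟩ := hDP.1.exists_norm_le
  rw [Metric.tendstoUniformlyOn_iff]
  intro ε hε
  obtain ⟨g, hg0, hg⟩ := exists_forall_apply_posPart_abs_sub_lt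
    (φ := fun n => NormedSpace.inclusionInDoubleDual ℝ F (y n))
    (fun n => DualLattice.le_iff.2 fun f hf => DualLattice.apply_nonneg hf (hy0 n))
    (fun n => (NormedSpace.double_dual_bound ℝ F (y n)).trans (hC _ (hyT n))) hV.1
    (fun f _ hfV hf δ hδ => by
      filter_upwards [Metric.tendstoUniformlyOn_iff.1 (hDP.2 f (hV.2 f hfV hf)) δ hδ] with n hn i
      have := hn _ (hyT i)
      rw [dist_comm, Real.dist_0_eq_abs] at this
      exact (le_abs_self _).trans_lt this)
    (half_pos hε)
  have hgy : Tendsto (fun n => g (y n)) atTop (𝓝 0) := hnull (g.comp T)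
  filter_upwards [hgy.eventually (gt_mem_nhds (half_pos hε))] with n hn
  rintro f ⟨f', hf', hff'⟩
  rw [dist_comm, Real.dist_0_eq_abs]
  have h1 : (|f'| - g)⁺ (y n) < ε / 2 := hg f' hf' n
  have h2 : (|f'| - g) (y n) ≤ (|f'| - g)⁺ (y n) :=
    DualLattice.le_iff.1 (le_posPart (|f'| - g)) _ (hy0 n)
  rw [sub_apply] at h2
  calc |f (T (x n))| ≤ |f| |T (x n)| := DualLattice.abs_apply_le f _
    _ ≤ |f| (y n) := DualLattice.apply_mono (abs_nonneg f) (abs_apply_le_apply_abs hTpos _)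
    _ ≤ |f'| (y n) := DualLattice.le_iff.1 hff' _ (hy0 n)
    _ < ε := by linarith

end

theorem mainTheorem3
    {E : Type*} [NormedAddCommGroup E] [NormedSpace ℝ E] [CompleteSpace E] [Lattice E]
    [IsOrderedAddMonoid E] [IsOrderedModule ℝ E] [HasSolidNorm E]
    {F : Type*} [NormedAddCommGroup F] [NormedSpace ℝ F] [CompleteSpace F] [Lattice F]
    [IsOrderedAddMonoid F] [IsOrderedModule ℝ F] [HasSolidNorm F]
    (T : E →L[ℝ] F) (hTpos : ∀ x : E, 0 ≤ x → 0 ≤ T x) (hT : IsDWDPOperator T)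
    (W : Set E) (hW : IsDisjointlyWeaklyCompact W)
    (V : Set (StrongDual ℝ F)) (hV : IsDisjointlyWeaklyCompact V) :
    (∀ x : ℕ → E, (∀ n, x n ∈ solidClosure W) → IsDisjointSeq x →
      TendstoUniformlyOn (fun n (f : StrongDual ℝ F) => f (T (x n))) (fun _ => 0) atTop
        (solidClosure V)) ∧
    (∀ ε : ℝ, 0 < ε → ∃ u : E, 0 ≤ u ∧
      ∀ x ∈ W, ∀ f ∈ V, |f| (T ((|x| - u)⁺)) < ε) := by
  have h1 : ∀ x : ℕ → E, (∀ n, x n ∈ solidClosure W) → IsDisjointSeq x →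
      TendstoUniformlyOn (fun n (f : StrongDual ℝ F) => f (T (x n))) (fun _ => 0) atTop
        (solidClosure V) := fun x hxW hx =>
    hT.tendstoUniformlyOn_solidClosure hTpos hW hV hxW hx
  refine ⟨h1, fun ε hε => ?_⟩
  obtain ⟨C, hC⟩ := hV.1.exists_norm_le
  obtain ⟨u, hu0, hu⟩ := exists_forall_apply_posPart_abs_sub_lt
    (φ := fun f : V => |(f : StrongDual ℝ F)|.comp T) (C := C * ‖T‖)
    (fun f => DualLattice.le_iff.2 fun x hx =>
      DualLattice.apply_nonneg (abs_nonneg (f : StrongDual ℝ F)) (hTpos x hx))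
    (fun f => (ContinuousLinearMap.opNorm_comp_le _ T).trans (by
      gcongr
      rw [norm_abs_eq_norm]
      exact hC _ f.2)) hW.1
    (fun x _ hxW hx δ hδ => by
      filter_upwards [Metric.tendstoUniformlyOn_iff.1 (h1 x hxW hx) δ hδ] with n hn f
      have := hn |(f : StrongDual ℝ F)| ⟨_, f.2, (abs_abs _).le⟩
      rw [dist_comm, Real.dist_0_eq_abs] at this
      exact (le_abs_self _).trans_lt this)
    hε
  exact ⟨u, hu0, fun x hx f hf => hu x hx ⟨f, hf⟩⟩
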